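/- Let $B \in \mathbb{C}^{M\times N}$ have singular values $\sigma_1(B) \ge \sigma_2(B) \ge \dots$ (with $\sigma_i(B)=0$ for $i > \min\{M,N\}$). Let $b \ge 1$, $t \ge 0$ and $r \ge 0$ be integers, let $\varepsilon > 0$, and assume $\sum_{i=r+1}^N \sigma_i(B)^2 > 0$. For a set $S \subseteq \{1,\dots,N\}$ of pivots, the pivoted $\mathsf{QR}$ approximation of $B$ is $\Pi_S B$, where $\Pi_S$ is the orthogonal projector onto the span of the columns of $B$ indexed by $S$, and the residual is $B - \Pi_S B$. Consider the following two random procedures. Both start with $S=\emptyset$ and run for $t$ rounds. In each round, let $C = B - \Pi_S B$ be the current residual; if $C=0$, nothing changes, and otherwise $b$ indices $s_1',\dots,s_b'$ are drawn independently with $\mathbb{P}\{s'=j\} = \|C(:,j)\|^2/\|C\|_{\rm F}^2$. * *Block randomly pivoted $\mathsf{QR}$*: replace $S$ by $S \cup \{s_1',\dots,s_b'\}$. * *Accelerated randomly pivoted $\mathsf{QR}$*: form the $b\times b$ Gram matrix $H = C(:,(s_1',\dots,s_b'))^* C(:,(s_1',\dots,s_b'))$ and let $u$ be its diagonal. For $i=1,\dots,b$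 in turn, accept $s_i'$ with probability $H(i,i)/u_i$ (using fresh randomness) for the current $H$; upon acceptance, replace $H$ by $H - H(:,i)H(:,i)^*/H(i,i)$. Then add the accepted indices to $S$. Let $B^{(t)} = B - \Pi_S B$ denote the random residual after $t$ rounds of either procedure. Then, for each of the two procedures, $$\mathbb{E}\,\|B^{(t)}\|_{\rm F}^2 \le (1+\varepsilon) \sum_{i=r+1}^N \sigma_i(B)^2$$ as soon as $$tb \ge \frac{r}{\varepsilon} + (r+b)\log\Bigl(\frac{1}{\varepsilon\eta}\Bigr), \qquad\text{where } \eta = \frac{\sum_{i=r+1}^N \sigma_i(B)^2}{\sum_{i=1}^r \sigma_i(B)^2}.$$ If $r = 0$ (so that $\eta = +\infty$), the condition on $tb$ is regarded as satisfied for every $t \ge 0$. -/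

import Mathlib

open scoped ENNReal NNReal Matrix.Norms.Frobenius

noncomputable section

namespace RPQR

variable {M N b : ℕ}

/-- The `j`-th column of `B`, as a vector of the Euclidean space `ℂ^M`. -/
def column (B : Matrix (Fin M) (Fin N) ℂ) (j : Fin N) : EuclideanSpace ℂ (Fin M) :=
  WithLp.toLp 2 (fun i => B i j)

/-- The column-pivoted QR approximation of `B` with pivot set `S`: if the columns of `Q` form an
orthonormal basis of the span of the pivot columns `B(:,S)`, and `F = Bᴴ Q`, then this is
`Q Fᴴ = Q Qᴴ B`, i.e. every column of `B` is projected orthogonally onto that span. -/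
def qrApproximation (B : Matrix (Fin M) (Fin N) ℂ) (S : Finset (Fin N)) :
    Matrix (Fin M) (Fin N) ℂ :=
  Matrix.of fun i j => (Submodule.span ℂ (column B '' (S : Set (Fin N)))).starProjection (column B j) i

/-- The residual of column-pivoted QR with pivot set `S`. -/
def qrResidual (B : Matrix (Fin M) (Fin N) ℂ) (S : Finset (Fin N)) : Matrix (Fin M) (Fin N) ℂ :=
  B - qrApproximation B S

/-- Squared Euclidean norms of the columns. -/
def squaredColumnNorms (C : Matrix (Fin M) (Fin N) ℂ) (j : Fin N) : ℝ :=
  ∑ i, ‖C i j‖ ^ 2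

theorem tsum_squaredColumnNorms_ne_zero {C : Matrix (Fin M) (Fin N) ℂ} (hC : C ≠ 0) :
    ∑' j, ENNReal.ofReal (squaredColumnNorms C j) ≠ 0 := by
  intro h
  apply hC
  ext i j
  rw [ENNReal.tsum_eq_zero] at h
  have hj := ENNReal.ofReal_eq_zero.mp (h j)
  have h1 : ‖C i j‖ ^ 2 ≤ squaredColumnNorms C j :=
    Finset.single_le_sum (f := fun i => ‖C i j‖ ^ 2) (fun _ _ => by positivity)
      (Finset.mem_univ i)
  have h2 : ‖C i j‖ ^ 2 = 0 := le_antisymm (h1.trans hj) (by positivity)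
  simpa using h2

theorem tsum_squaredColumnNorms_ne_top (C : Matrix (Fin M) (Fin N) ℂ) :
    ∑' j, ENNReal.ofReal (squaredColumnNorms C j) ≠ ∞ := by
  rw [tsum_fintype]
  exact ENNReal.sum_ne_top.mpr fun _ _ => ENNReal.ofReal_ne_top

/-- The proposal distribution `ℙ{s = j} = ‖C(:,j)‖² / ∑ₖ ‖C(:,k)‖²`, for a nonzero matrix `C`. -/
def proposalLaw (C : Matrix (Fin M) (Fin N) ℂ) (hC : C ≠ 0) : PMF (Fin N) :=
  PMF.normalize (fun j => ENNReal.ofReal (squaredColumnNorms C j))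
    (tsum_squaredColumnNorms_ne_zero hC) (tsum_squaredColumnNorms_ne_top C)

theorem sum_prod_eq_one (b : ℕ) (p : PMF (Fin N)) :
    ∑ s : Fin b → Fin N, ∏ l, p (s l) = 1 := by
  have h : ∑ j, p j = 1 := by simpa [tsum_fintype] using p.tsum_coe
  have h2 := (Finset.prod_univ_sum (fun _ : Fin b => (Finset.univ : Finset (Fin N)))
    (fun _ j => p j)).symm
  simpa [h, Fintype.piFinset_univ] using h2

/-- The law of `b` independent draws from `p`. -/
def iidLaw (b : ℕ) (p : PMF (Fin N)) : PMF (Fin b → Fin N) :=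
  PMF.ofFintype (fun s => ∏ l, p (s l)) (sum_prod_eq_one b p)

/-- The probability of the event `u * Rand < h`, with `Rand` uniform on `[0, 1)` and `0 ≤ u`
(for `u = 0` the formula gives `0`, which is right because then also `h ≤ 0` in the algorithm). -/
def acceptanceProb (u h : ℝ) : ℝ≥0 := min 1 (h / u).toNNReal

/-- A coin that shows `true` with probability `p`. -/
def coin (p : ℝ≥0) (hp : p ≤ 1) : PMF Bool :=
  PMF.ofFintype (fun c => cond c (p : ℝ≥0∞) (1 - p)) (by simp [hp])

/-- Elimination of the accepted index `i` by a Cholesky step: `H - L Lᴴ` with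
`L = H(:,i) / √H(i,i)`. (Rows and columns of positions already processed are never read again.) -/
def choleskyStep (H : Matrix (Fin b) (Fin b) ℂ) (i : Fin b) : Matrix (Fin b) (Fin b) ℂ :=
  Matrix.of fun j k => H j k - H j i * star (H k i) / H i i

/-- The accept/reject loop over a list of positions; `u` is the initial diagonal and `H` the
current matrix. The outcome is the set of accepted positions. -/
def rejectionLoop (u : Fin b → ℝ) :
    List (Fin b) → Matrix (Fin b) (Fin b) ℂ → PMF (Finset (Fin b))
  | [], _ => PMF.pure ∅
  | i :: l, H =>
    (coin (acceptanceProb (u i) (H i i).re) (min_le_left _ _)).bind fun c =>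
      if c then (rejectionLoop u l (choleskyStep H i)).map (insert i) else rejectionLoop u l H

/-- The law of the accepted positions in `RejectionSampleSubmatrix`, run on a psd matrix `H`:
the positions `1, …, b` are examined in this order. -/
def rejectionSample (H : Matrix (Fin b) (Fin b) ℂ) : PMF (Finset (Fin b)) :=
  rejectionLoop (fun i => (H i i).re) (List.finRange b) H

open Classical in
/-- One round of block randomly pivoted QR, from the pivot set `S`: draw `b` independent pivots
from the squared column norms of the residual and induct all of them. If the residual vanishes
(the factorization is exact, and there is no proposal distribution), nothing changes. -/
def blockRound (b : ℕ) (B : Matrix (Fin M) (Fin N) ℂ) (S : Finset (Fin N)) :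
    PMF (Finset (Fin N)) :=
  if hC : qrResidual B S ≠ 0 then
    (iidLaw b (proposalLaw (qrResidual B S) hC)).map fun s => S ∪ Finset.univ.image s
  else PMF.pure S

open Classical in
/-- One round of accelerated randomly pivoted QR, from the pivot set `S`: draw `b` independent
proposals from the squared column norms of the residual, thin them by rejection sampling with the
Gram matrix `Cᴴ C` of the proposed residual columns, and induct the accepted ones. If the residual
vanishes, nothing changes. -/
def acceleratedRound (b : ℕ) (B : Matrix (Fin M) (Fin N) ℂ) (S : Finset (Fin N)) :
    PMF (Finset (Fin N)) :=
  if hC : qrResidual B S ≠ 0 then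
    (iidLaw b (proposalLaw (qrResidual B S) hC)).bind fun s =>
      let C : Matrix (Fin M) (Fin b) ℂ := (qrResidual B S).submatrix id s
      (rejectionSample (C.conjTranspose * C)).map fun T => S ∪ T.image s
  else PMF.pure S

/-- The law of the pivot set after `t` rounds of block randomly pivoted QR. -/
def blockPivots (b : ℕ) (B : Matrix (Fin M) (Fin N) ℂ) : ℕ → PMF (Finset (Fin N))
  | 0 => PMF.pure ∅
  | t + 1 => (blockPivots b B t).bind (blockRound b B)

/-- The law of the pivot set after `t` rounds of accelerated randomly pivoted QR. -/
def acceleratedPivots (b : ℕ) (B : Matrix (Fin M) (Fin N) ℂ) : ℕ → PMF (Finset (Fin N))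
  | 0 => PMF.pure ∅
  | t + 1 => (acceleratedPivots b B t).bind (acceleratedRound b B)

/-- The expected squared Frobenius norm of the residual, for a random pivot set of law `p`. -/
def expectedSquaredError (B : Matrix (Fin M) (Fin N) ℂ) (p : PMF (Finset (Fin N))) : ℝ :=
  ∑ S, (p S).toReal * ‖qrResidual B S‖ ^ 2

/-- The singular values in decreasing order, extended by zeros; indices start at `0`, so that
`sigma B i` is the `(i+1)`-st singular value. -/
def sigma (B : Matrix (Fin M) (Fin N) ℂ) (i : ℕ) : ℝ :=
  (Matrix.toEuclideanLin B).singularValues i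

/-- The sum of the `r` largest squared singular values. -/
def headSum (B : Matrix (Fin M) (Fin N) ℂ) (r : ℕ) : ℝ := ∑ i ∈ Finset.range r, sigma B i ^ 2

/-- The sum of the squared singular values number `r + 1, …, N`. -/
def tailSum (B : Matrix (Fin M) (Fin N) ℂ) (r : ℕ) : ℝ := ∑ i ∈ Finset.Ico r N, sigma B i ^ 2

end RPQR

end

/-!
Write `C = B - Π_S B` for the residual with pivot set `S`, and let `v₁, v₂, …` be right singular
vectors of `B`. The argument follows a single scalar, the head mass `α(S) = ∑_{k ≤ r} ‖C v_k‖²`.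
Since `‖C v_k‖ ≤ ‖B v_k‖`, the remaining directions contribute at most the tail sum `β`, so
`‖C‖² ≤ α(S) + β` (`norm_qrResidual_sq_le`), and it suffices to bring `𝔼 α` below `ε β`.

*One proposal.* When a proposal is examined while the current residual columns are `c_j`, drawing
and rejection together add index `j` to the pivot set with probability `‖c_j‖² / τ`, where `τ` is the
squared norm of the residual at the start of the round. Drawing all proposals in advance is the
same as drawing each when it is examined (`sum_prod_mul_thinnedValue`), and a Cholesky step
on the Gram matrix is a Gram–Schmidt step on the residual
(`choleskyStep_residualGram`). Adding `j` lowers `‖C v_k‖²` by `|⟨c_j, C v_k⟩|² / ‖c_j‖²`, so the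
expected decrease of `α` is `∑_{k ≤ r} ‖Cᴴ C v_k‖² / τ`, which by Cauchy–Schwarz is at least
`α² / (r τ)` (`headMass_sq_le`).

*One round.* By Jensen's inequality, `b` proposals bring `α` down to at most
`(1 / α + b / (r τ))⁻¹` (`expectation_acceleratedRound_headMass`). This parallel sum is the minimum
over `θ` of `θ² α + (1 - θ)² r τ / b`, and these linear bounds survive averaging over `S`. Within a
round, block pivoting keeps a superset of the accepted pivots, so it obeys the same bounds
(`expectation_blockRound_le`).

*All rounds.* Hence `x_t = 𝔼 α` satisfies `1 / x_{t+1} ≥ 1 / x_t + b / (r (x_t + β))`. Each such step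
raises `(r + b) log (1 / x) + r β / x` by at least `b` (`le_potential_sub_potential`), and as long as
`x_t > ε β` this potential has grown by less than `r / ε + (r + b) log (1 / (ε η))`.
-/

noncomputable section

namespace RPQR

variable {M N b : ℕ}

/-! ### Projecting off the pivot columns -/

/-- The span of the pivot columns `B(:,S)`. -/
def pivotSpan (B : Matrix (Fin M) (Fin N) ℂ) (S : Finset (Fin N)) :
    Submodule ℂ (EuclideanSpace ℂ (Fin M)) :=
  Submodule.span ℂ (column B '' (S : Set (Fin N)))

/-- The orthogonal projection onto the complement of the span of the pivot columns; it carries the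
columns of `B` to those of the residual. -/
def residualMap (B : Matrix (Fin M) (Fin N) ℂ) (S : Finset (Fin N)) :
    EuclideanSpace ℂ (Fin M) →L[ℂ] EuclideanSpace ℂ (Fin M) :=
  (pivotSpan B S)ᗮ.starProjection

section Residual

variable (B : Matrix (Fin M) (Fin N) ℂ) (S : Finset (Fin N))

theorem residualMap_apply (x : EuclideanSpace ℂ (Fin M)) :
    residualMap B S x = x - (pivotSpan B S).starProjection x :=
  Submodule.starProjection_orthogonal_val x

theorem residualMap_empty (x : EuclideanSpace ℂ (Fin M)) : residualMap B ∅ x = x := by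
  simp [residualMap_apply, pivotSpan]

theorem residualMap_mem_orthogonal (x : EuclideanSpace ℂ (Fin M)) :
    residualMap B S x ∈ (pivotSpan B S)ᗮ :=
  Submodule.starProjection_apply_mem _ _

theorem column_qrResidual (j : Fin N) :
    column (qrResidual B S) j = residualMap B S (column B j) := by
  ext i
  simp [residualMap_apply, column, qrResidual, qrApproximation, pivotSpan]

theorem residualMap_mono {S S' : Finset (Fin N)} (h : S ⊆ S') (x : EuclideanSpace ℂ (Fin M)) :
    ‖residualMap B S' x‖ ≤ ‖residualMap B S x‖ := by
  have hle : pivotSpan B S ≤ pivotSpan B S' :=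
    Submodule.span_mono (Set.image_mono (by exact_mod_cast h))
  have h1 : residualMap B S' x = (pivotSpan B S')ᗮ.starProjection (residualMap B S x) := by
    have h0 : (pivotSpan B S')ᗮ.starProjection ((pivotSpan B S).starProjection x) = 0 := by
      rw [Submodule.starProjection_apply_eq_zero_iff]
      exact Submodule.le_orthogonal_orthogonal _
        (hle (Submodule.starProjection_apply_mem _ _))
    rw [residualMap_apply B S, map_sub, h0, sub_zero]
    rfl
  rw [h1]
  exact Submodule.norm_starProjection_apply_le _ _

theorem inner_column_of_mem_orthogonal (j : Fin N) {y : EuclideanSpace ℂ (Fin M)}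
    (hy : y ∈ (pivotSpan B S)ᗮ) :
    inner ℂ (column B j) y = inner ℂ (residualMap B S (column B j)) y := by
  rw [residualMap_apply, inner_sub_left,
    (Submodule.mem_orthogonal _ _).1 hy _ (Submodule.starProjection_apply_mem _ _), sub_zero]

/-- One Gram–Schmidt step: a further pivot `j` removes the component along its residual column.
If that column vanishes, the coefficient is the junk value `0`, which is right because then the
span of the pivot columns does not change. -/
theorem residualMap_insert (j : Fin N) (x : EuclideanSpace ℂ (Fin M)) :
    residualMap B (insert j S) x = residualMap B S x -
      (inner ℂ (residualMap B S (column B j)) (residualMap B S x) /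
        (‖residualMap B S (column B j)‖ : ℂ) ^ 2) • residualMap B S (column B j) := by
  set c := residualMap B S (column B j) with hc
  set y := residualMap B S x - (inner ℂ c (residualMap B S x) / (‖c‖ : ℂ) ^ 2) • c with hy
  have hle : pivotSpan B S ≤ pivotSpan B (insert j S) :=
    Submodule.span_mono (Set.image_mono (by simp))
  have hyS : y ∈ (pivotSpan B S)ᗮ :=
    Submodule.sub_mem _ (residualMap_mem_orthogonal B S x)
      (Submodule.smul_mem _ _ (residualMap_mem_orthogonal B S _))
  apply Submodule.eq_starProjection_of_mem_orthogonal
  · rw [Submodule.mem_orthogonal]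
    intro u hu
    induction hu using Submodule.span_induction with
    | mem u hu =>
      obtain ⟨k, hk, rfl⟩ := hu
      rcases Finset.mem_insert.1 (Finset.mem_coe.1 hk) with rfl | hk
      · rw [inner_column_of_mem_orthogonal B S k hyS, ← hc, hy, inner_sub_right, inner_smul_right,
          inner_self_eq_norm_sq_to_K]
        by_cases h0 : c = 0
        · simp [h0]
        · have : (‖c‖ : ℂ) ≠ 0 := by simpa using h0
          simp only [Complex.coe_algebraMap]
          field_simp
          ring
      · exact (Submodule.mem_orthogonal _ _).1 hyS _ (Submodule.subset_span ⟨k, hk, rfl⟩)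
    | zero => simp
    | add u w _ _ hu hw => rw [inner_add_left, hu, hw, add_zero]
    | smul a u _ hu => rw [inner_smul_left, hu, mul_zero]
  · apply Submodule.le_orthogonal_orthogonal
    have hcm : c ∈ pivotSpan B (insert j S) := by
      rw [hc, residualMap_apply]
      exact Submodule.sub_mem _ (Submodule.subset_span ⟨j, by simp, rfl⟩)
        (hle (Submodule.starProjection_apply_mem _ _))
    have : x - y = (pivotSpan B S).starProjection x + (inner ℂ c (residualMap B S x) /
        (‖c‖ : ℂ) ^ 2) • c := by
      rw [hy, residualMap_apply]
      abel
    rw [this]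
    exact Submodule.add_mem _ (hle (Submodule.starProjection_apply_mem _ _))
      (Submodule.smul_mem _ _ hcm)

theorem inner_residualMap_insert (j : Fin N) (x y : EuclideanSpace ℂ (Fin M)) :
    inner ℂ (residualMap B (insert j S) x) (residualMap B (insert j S) y) =
      inner ℂ (residualMap B S x) (residualMap B S y) -
        inner ℂ (residualMap B S x) (residualMap B S (column B j)) *
          inner ℂ (residualMap B S (column B j)) (residualMap B S y) /
          (‖residualMap B S (column B j)‖ : ℂ) ^ 2 := by
  rw [residualMap_insert, residualMap_insert]
  set c := residualMap B S (column B j)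
  set x' := residualMap B S x
  set y' := residualMap B S y
  simp only [inner_sub_left, inner_sub_right, inner_smul_left, inner_smul_right,
    inner_self_eq_norm_sq_to_K, map_div₀, map_pow, inner_conj_symm, Complex.conj_ofReal]
  by_cases h0 : c = 0
  · simp [h0]
  · have : (‖c‖ : ℂ) ≠ 0 := by simpa using h0
    simp only [Complex.coe_algebraMap]
    field_simp
    ring

theorem norm_residualMap_insert_sq (j : Fin N) (x : EuclideanSpace ℂ (Fin M)) :
    ‖residualMap B (insert j S) x‖ ^ 2 = ‖residualMap B S x‖ ^ 2 -
      ‖inner ℂ (residualMap B S (column B j)) (residualMap B S x)‖ ^ 2 /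
        ‖residualMap B S (column B j)‖ ^ 2 := by
  have h := inner_residualMap_insert B S j x x
  rw [← inner_conj_symm (residualMap B S x) (residualMap B S (column B j)),
    Complex.conj_mul', inner_self_eq_norm_sq_to_K, inner_self_eq_norm_sq_to_K] at h
  simp only [Complex.coe_algebraMap] at h
  exact_mod_cast h

/-! ### Residual columns and their Gram matrices -/

/-- The squared norm of column `j` of the residual with pivot set `S`. -/
def columnMass (S : Finset (Fin N)) (j : Fin N) : ℝ := ‖residualMap B S (column B j)‖ ^ 2

theorem columnMass_nonneg (j : Fin N) : 0 ≤ columnMass B S j := by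
  unfold columnMass; positivity

theorem columnMass_antitone {S S' : Finset (Fin N)} (h : S ⊆ S') (j : Fin N) :
    columnMass B S' j ≤ columnMass B S j :=
  pow_le_pow_left₀ (norm_nonneg _) (residualMap_mono B h _) 2

theorem squaredColumnNorms_qrResidual (j : Fin N) :
    squaredColumnNorms (qrResidual B S) j = columnMass B S j := by
  rw [columnMass, ← column_qrResidual, EuclideanSpace.norm_sq_eq]
  rfl

theorem norm_qrResidual_sq : ‖qrResidual B S‖ ^ 2 = ∑ j, columnMass B S j := by
  simp_rw [← squaredColumnNorms_qrResidual, squaredColumnNorms]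
  rw [Finset.sum_comm, Matrix.frobenius_norm_def, ← Real.rpow_natCast, ← Real.rpow_mul
    (Finset.sum_nonneg fun _ _ => Finset.sum_nonneg fun _ _ => by positivity)]
  norm_num

/-- The Gram matrix of the residual columns with indices `s 1, …, s b`. -/
def residualGram (s : Fin b → Fin N) : Matrix (Fin b) (Fin b) ℂ :=
  Matrix.of fun i k => inner ℂ (residualMap B S (column B (s i))) (residualMap B S (column B (s k)))

theorem conjTranspose_mul_submatrix_qrResidual (s : Fin b → Fin N) :
    ((qrResidual B S).submatrix id s).conjTranspose * (qrResidual B S).submatrix id s =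
      residualGram B S s := by
  ext i k
  rw [residualGram, Matrix.of_apply, ← column_qrResidual, ← column_qrResidual,
    PiLp.inner_apply, Matrix.mul_apply]
  simp [column, mul_comm]

theorem residualGram_diag_re (s : Fin b → Fin N) (i : Fin b) :
    (residualGram B S s i i).re = columnMass B S (s i) := by
  rw [residualGram, Matrix.of_apply, columnMass, ← inner_self_eq_norm_sq (𝕜 := ℂ)]
  rfl

/-- A Cholesky step turns the residual Gram matrix into that for the enlarged pivot set. -/
theorem choleskyStep_residualGram (s : Fin b → Fin N) (i : Fin b) :
    choleskyStep (residualGram B S s) i = residualGram B (insert (s i) S) s := by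
  ext j k
  simp only [choleskyStep, residualGram, Matrix.of_apply, inner_residualMap_insert]
  rw [inner_self_eq_norm_sq_to_K]
  congr 2
  rw [← inner_conj_symm (residualMap B S (column B (s i))) (residualMap B S (column B (s k)))]
  rfl

/-! ### Mass in the leading singular directions -/

theorem toEuclideanLin_eq_sum_column (v : EuclideanSpace ℂ (Fin N)) :
    Matrix.toEuclideanLin B v = ∑ j, v j • column B j := by
  ext i
  simp [column, Matrix.mulVec, dotProduct, mul_comm]

/-- An orthonormal basis of right singular vectors of `B`, by decreasing singular values. -/
def singularBasis : OrthonormalBasis (Fin N) ℂ (EuclideanSpace ℂ (Fin N)) :=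
  (Matrix.toEuclideanLin B).isSymmetric_adjoint_comp_self.eigenvectorBasis
    finrank_euclideanSpace_fin

theorem norm_apply_singularBasis_sq (k : Fin N) :
    ‖Matrix.toEuclideanLin B (singularBasis B k)‖ ^ 2 = sigma B k ^ 2 := by
  generalize hT : Matrix.toEuclideanLin B = T
  have h := T.isSymmetric_adjoint_comp_self.apply_eigenvectorBasis finrank_euclideanSpace_fin k
  have hv : singularBasis B =
      T.isSymmetric_adjoint_comp_self.eigenvectorBasis finrank_euclideanSpace_fin := by
    subst hT; rfl
  rw [← hv, LinearMap.comp_apply] at h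
  rw [sigma, hT, T.sq_singularValues_fin finrank_euclideanSpace_fin k,
    ← inner_self_eq_norm_sq (𝕜 := ℂ), ← LinearMap.adjoint_inner_right, h, inner_smul_right,
    inner_self_eq_norm_sq_to_K, OrthonormalBasis.norm_eq_one]
  simp

/-- The part of the squared Frobenius norm of the residual with pivot set `S` that is carried by
the `r` leading right singular vectors of `B`. -/
def headMass (r : ℕ) (S : Finset (Fin N)) : ℝ :=
  ∑ k : Fin N with k.1 < r, ‖residualMap B S (Matrix.toEuclideanLin B (singularBasis B k))‖ ^ 2

theorem headMass_nonneg (r : ℕ) : 0 ≤ headMass B r S :=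
  Finset.sum_nonneg fun _ _ => by positivity

theorem headMass_antitone (r : ℕ) : Antitone (headMass B r) := fun _ _ h =>
  Finset.sum_le_sum fun _ _ => pow_le_pow_left₀ (norm_nonneg _) (residualMap_mono B h _) 2

theorem headMass_empty {r : ℕ} (hr : r ≤ N) : headMass B r ∅ = headSum B r := by
  simp only [headMass, residualMap_empty, norm_apply_singularBasis_sq, headSum]
  rw [Finset.sum_filter, Fin.sum_univ_eq_sum_range (fun k => if k < r then sigma B k ^ 2 else 0),
    ← Finset.sum_filter]
  congr 1
  ext k
  simp only [Finset.mem_filter, Finset.mem_range]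
  omega

/-- The squared Hilbert–Schmidt norm does not depend on the orthonormal basis. -/
theorem sum_norm_sq_orthonormalBasis {ι E F : Type*} [Fintype ι]
    [NormedAddCommGroup E] [InnerProductSpace ℂ E] [FiniteDimensional ℂ E]
    [NormedAddCommGroup F] [InnerProductSpace ℂ F] [FiniteDimensional ℂ F]
    (L : E →ₗ[ℂ] F) (v : OrthonormalBasis ι ℂ E) :
    ((∑ i, ‖L (v i)‖ ^ 2 : ℝ) : ℂ) = LinearMap.trace ℂ E (L.adjoint ∘ₗ L) := by
  rw [LinearMap.trace_eq_sum_inner _ v, Complex.ofReal_sum]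
  refine Finset.sum_congr rfl fun i _ => ?_
  rw [LinearMap.comp_apply, LinearMap.adjoint_inner_right, inner_self_eq_norm_sq_to_K]
  simp

/-- Outside the `r` leading singular directions, projecting off pivot columns only shrinks the images
`B v_k`, whose squared norms add up to the tail sum. -/
theorem norm_qrResidual_sq_le {r : ℕ} :
    ‖qrResidual B S‖ ^ 2 ≤ headMass B r S + tailSum B r := by
  have h1 : ∑ j, columnMass B S j =
      ∑ k, ‖residualMap B S (Matrix.toEuclideanLin B (singularBasis B k))‖ ^ 2 := by
    let L := (residualMap B S).toLinearMap ∘ₗ Matrix.toEuclideanLin B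
    have h := (sum_norm_sq_orthonormalBasis L (EuclideanSpace.basisFun (Fin N) ℂ)).trans
      (sum_norm_sq_orthonormalBasis L (singularBasis B)).symm
    refine Eq.trans (Finset.sum_congr rfl fun j _ => ?_) (Complex.ofReal_injective h)
    rw [columnMass, LinearMap.comp_apply, toEuclideanLin_eq_sum_column]
    simp [PiLp.single_apply]
  have h2 : ∑ k : Fin N with ¬ k.1 < r,
      ‖residualMap B S (Matrix.toEuclideanLin B (singularBasis B k))‖ ^ 2 ≤ tailSum B r := by
    calc _ ≤ ∑ k : Fin N with ¬ k.1 < r, sigma B k ^ 2 := by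
          refine Finset.sum_le_sum fun k _ => ?_
          rw [← norm_apply_singularBasis_sq]
          refine pow_le_pow_left₀ (norm_nonneg _) ?_ 2
          simpa only [residualMap_empty] using residualMap_mono B (Finset.empty_subset S)
            (Matrix.toEuclideanLin B (singularBasis B k))
      _ = tailSum B r := by
          rw [tailSum, Finset.sum_filter,
            Fin.sum_univ_eq_sum_range (fun k => if ¬ k < r then sigma B k ^ 2 else 0),
            ← Finset.sum_filter]
          congr 1
          ext k
          simp only [Finset.mem_filter, Finset.mem_range, Finset.mem_Ico]
          omega
  rw [norm_qrResidual_sq, h1, ← Finset.sum_filter_add_sum_filter_not _ (fun k : Fin N => k.1 < r)]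
  exact add_le_add le_rfl h2

/-- Writing `C = R B` for the residual, this is `‖C v‖⁴ ≤ ‖Cᴴ C v‖²` for a unit vector `v`. -/
theorem norm_residualMap_pow_four_le {v : EuclideanSpace ℂ (Fin N)} (hv : ‖v‖ = 1) :
    (‖residualMap B S (Matrix.toEuclideanLin B v)‖ ^ 2) ^ 2 ≤
      ∑ j, ‖inner ℂ (residualMap B S (column B j))
        (residualMap B S (Matrix.toEuclideanLin B v))‖ ^ 2 := by
  set x := residualMap B S (Matrix.toEuclideanLin B v) with hx
  have h1 : x = ∑ j, v j • residualMap B S (column B j) := by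
    rw [hx, toEuclideanLin_eq_sum_column, map_sum]
    simp
  have h2 : ‖x‖ ^ 2 ≤ ∑ j, ‖v j‖ * ‖inner ℂ (residualMap B S (column B j)) x‖ := by
    have h3 : ((‖x‖ ^ 2 : ℝ) : ℂ) =
        ∑ j, (starRingEnd ℂ) (v j) * inner ℂ (residualMap B S (column B j)) x := by
      have := inner_self_eq_norm_sq_to_K (𝕜 := ℂ) x
      conv at this => lhs; arg 2; rw [h1]
      rw [sum_inner] at this
      simp only [inner_smul_left] at this
      rw [this]
      simp
    have h4 := congrArg norm h3
    rw [Complex.norm_real, Real.norm_of_nonneg (by positivity)] at h4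
    rw [h4]
    refine (norm_sum_le _ _).trans (le_of_eq ?_)
    simp
  have h5 : ∑ j, ‖v j‖ ^ 2 = 1 := by rw [← EuclideanSpace.norm_sq_eq, hv, one_pow]
  calc (‖x‖ ^ 2) ^ 2 ≤ (∑ j, ‖v j‖ * ‖inner ℂ (residualMap B S (column B j)) x‖) ^ 2 := by gcongr
    _ ≤ (∑ j, ‖v j‖ ^ 2) * ∑ j, ‖inner ℂ (residualMap B S (column B j)) x‖ ^ 2 :=
      Finset.sum_mul_sq_le_sq_mul_sq _ _ _
    _ = _ := by rw [h5, one_mul]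

/-- The sum on the right is the expected decrease of the head mass, up to a normalizing factor, when
column `j` of the residual is added with probability proportional to its mass. By Cauchy–Schwarz
it is at least the squared head mass divided by `r`. -/
theorem headMass_sq_le (r : ℕ) :
    headMass B r S ^ 2 ≤
      r * ∑ j, columnMass B S j * (headMass B r S - headMass B r (insert j S)) := by
  have h1 : ∀ j, columnMass B S j * (headMass B r S - headMass B r (insert j S)) =
      ∑ k : Fin N with k.1 < r, ‖inner ℂ (residualMap B S (column B j))
        (residualMap B S (Matrix.toEuclideanLin B (singularBasis B k)))‖ ^ 2 := by
    intro j
    rw [headMass, headMass, ← Finset.sum_sub_distrib, Finset.mul_sum]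
    refine Finset.sum_congr rfl fun k _ => ?_
    rw [norm_residualMap_insert_sq, columnMass]
    by_cases h0 : residualMap B S (column B j) = 0
    · simp [h0]
    · have : ‖residualMap B S (column B j)‖ ≠ 0 := by simpa using h0
      field_simp
      ring
  have hcard : (Finset.univ.filter fun k : Fin N => k.1 < r).card ≤ r := by
    calc _ = ((Finset.univ.filter fun k : Fin N => k.1 < r).map Fin.valEmbedding).card := by simp
      _ ≤ (Finset.range r).card := Finset.card_le_card fun k hk => by
          simp only [Finset.mem_map, Finset.mem_filter] at hk
          obtain ⟨k, ⟨-, hk⟩, rfl⟩ := hk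
          simpa using hk
      _ = r := Finset.card_range r
  simp_rw [h1]
  rw [Finset.sum_comm]
  calc headMass B r S ^ 2 ≤ _ := sq_sum_le_card_mul_sum_sq
    _ ≤ _ := by
      gcongr with k
      exact norm_residualMap_pow_four_le B S (OrthonormalBasis.norm_eq_one _ k)

end Residual

/-! ### Expectations over finite types -/

section Expectation

variable {α β : Type*} [Fintype α] [Fintype β]

/-- The expectation of a real function on a finite type. -/
def expectation (p : PMF α) (f : α → ℝ) : ℝ := ∑ a, (p a).toReal * f a

theorem sum_toReal_eq_one (p : PMF α) : ∑ a, (p a).toReal = 1 := by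
  rw [← ENNReal.toReal_sum fun a _ => p.apply_ne_top a, ← tsum_fintype (L := .unconditional α),
    p.tsum_coe, ENNReal.toReal_one]

theorem expectation_mono (p : PMF α) {f g : α → ℝ} (h : ∀ a, f a ≤ g a) :
    expectation p f ≤ expectation p g :=
  Finset.sum_le_sum fun a _ => mul_le_mul_of_nonneg_left (h a) ENNReal.toReal_nonneg

theorem expectation_const (p : PMF α) (c : ℝ) : expectation p (fun _ => c) = c := by
  rw [expectation, ← Finset.sum_mul, sum_toReal_eq_one, one_mul]

theorem expectation_add (p : PMF α) (f g : α → ℝ) :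
    expectation p (fun a => f a + g a) = expectation p f + expectation p g := by
  simp [expectation, mul_add, Finset.sum_add_distrib]

theorem expectation_const_mul (p : PMF α) (c : ℝ) (f : α → ℝ) :
    expectation p (fun a => c * f a) = c * expectation p f := by
  simp only [expectation, Finset.mul_sum]
  exact Finset.sum_congr rfl fun _ _ => by ring

theorem expectation_pure (a : α) (f : α → ℝ) : expectation (PMF.pure a) f = f a := by
  classical
  simp [expectation, PMF.pure_apply, apply_ite ENNReal.toReal]

theorem expectation_bind (p : PMF α) (q : α → PMF β) (f : β → ℝ) :
    expectation (p.bind q) f = expectation p fun a => expectation (q a) f := by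
  simp only [expectation, PMF.bind_apply, tsum_fintype, Finset.mul_sum]
  rw [Finset.sum_comm]
  refine Finset.sum_congr rfl fun c _ => ?_
  rw [ENNReal.toReal_sum fun a _ => ENNReal.mul_ne_top (p.apply_ne_top a) ((q a).apply_ne_top c),
    Finset.sum_mul]
  exact Finset.sum_congr rfl fun a _ => by rw [ENNReal.toReal_mul, mul_assoc]

theorem expectation_map (p : PMF α) (g : α → β) (f : β → ℝ) :
    expectation (p.map g) f = expectation p fun a => f (g a) := by
  rw [← PMF.bind_pure_comp, expectation_bind]
  simp only [Function.comp_apply, expectation_pure]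

theorem expectation_coin (p : ℝ≥0) (hp : p ≤ 1) (f : Bool → ℝ) :
    expectation (coin p hp) f = p * f true + (1 - p) * f false := by
  have h : (1 - (p : ℝ≥0∞)).toReal = 1 - p := by
    rw [ENNReal.toReal_sub_of_le (by exact_mod_cast hp) ENNReal.one_ne_top]
    simp
  simp [expectation, coin, h]

end Expectation

/-! ### Drawing proposals one at a time -/

/-- Redrawing one coordinate does not change the expectation over independent draws: exchanging
that coordinate with the fresh draw preserves the product weights. -/
theorem sum_prod_resample (p : Fin N → ℝ) (hp : ∑ j, p j = 1) (h : (Fin b → Fin N) → ℝ)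
    (i : Fin b) :
    ∑ s, (∏ l, p (s l)) * h s =
      ∑ s, (∏ l, p (s l)) * ∑ j, p j * h (Function.update s i j) := by
  let e : (Fin b → Fin N) × Fin N → (Fin b → Fin N) × Fin N :=
    fun x => (Function.update x.1 i x.2, x.1 i)
  have he : Function.Involutive e := fun x => by simp [e]
  have hw : ∀ s j, (∏ l, p (Function.update s i j l)) * p (s i) = (∏ l, p (s l)) * p j := by
    intro s j
    have h1 := Finset.prod_update_of_mem (Finset.mem_univ i) (fun l => p (s l)) (p j)
    have h2 : (fun l => p (Function.update s i j l)) =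
        Function.update (fun l => p (s l)) i (p j) := by
      ext l
      by_cases hl : l = i
      · subst hl; simp
      · simp [hl]
    rw [show (∏ l, p (Function.update s i j l)) = _ from congrArg (fun f => ∏ l, f l) h2, h1,
      ← Finset.mul_prod_erase Finset.univ (fun l => p (s l)) (Finset.mem_univ i),
      Finset.sdiff_singleton_eq_erase]
    ring
  calc ∑ s, (∏ l, p (s l)) * h s
      = ∑ x : (Fin b → Fin N) × Fin N, (∏ l, p (x.1 l)) * p x.2 * h x.1 := by
        rw [Fintype.sum_prod_type]
        refine Finset.sum_congr rfl fun s _ => ?_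
        dsimp only
        rw [← Finset.sum_mul, ← Finset.mul_sum, hp, mul_one]
    _ = ∑ x : (Fin b → Fin N) × Fin N, (∏ l, p (x.1 l)) * p x.2 *
          h (Function.update x.1 i x.2) := by
        refine Fintype.sum_equiv he.toPerm _ _ fun x => ?_
        simp only [Function.Involutive.coe_toPerm, e, Function.update_idem, Function.update_eq_self]
        rw [hw]
    _ = _ := by
        rw [Fintype.sum_prod_type]
        refine Finset.sum_congr rfl fun s _ => ?_
        rw [Finset.mul_sum]
        exact Finset.sum_congr rfl fun j _ => by ring

/-- The expected value of `f` at the final pivot set when the proposals `s i`, for `i` in the list,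
are examined in turn, from the pivot set `S`, and `a j S` is the probability of accepting the
proposal `j` while the pivot set is `S`. -/
def thinnedValue (a : Fin N → Finset (Fin N) → ℝ) (f : Finset (Fin N) → ℝ) :
    List (Fin b) → Finset (Fin N) → (Fin b → Fin N) → ℝ
  | [], S, _ => f S
  | i :: l, S, s => a (s i) S * thinnedValue a f l (insert (s i) S) s +
      (1 - a (s i) S) * thinnedValue a f l S s

theorem thinnedValue_update (a : Fin N → Finset (Fin N) → ℝ) (f : Finset (Fin N) → ℝ)
    {i : Fin b} {l : List (Fin b)} (hi : i ∉ l) (S : Finset (Fin N)) (s : Fin b → Fin N)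
    (j : Fin N) :
    thinnedValue a f l S (Function.update s i j) = thinnedValue a f l S s := by
  induction l generalizing S with
  | nil => rfl
  | cons k l ih =>
    rw [List.mem_cons, not_or] at hi
    simp only [thinnedValue, ih hi.2, Function.update_of_ne (Ne.symm hi.1)]

/-- The Markov operator of one proposal: draw `j` with weight `p j` and add it to the pivot set
with probability `a j S`. -/
def proposalStep (p : Fin N → ℝ) (a : Fin N → Finset (Fin N) → ℝ) (f : Finset (Fin N) → ℝ)
    (S : Finset (Fin N)) : ℝ :=
  ∑ j, p j * (a j S * f (insert j S) + (1 - a j S) * f S)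

/-- Drawing all proposals in advance amounts to drawing each one when it is examined. -/
theorem sum_prod_mul_thinnedValue (p : Fin N → ℝ) (hp : ∑ j, p j = 1)
    (a : Fin N → Finset (Fin N) → ℝ) (f : Finset (Fin N) → ℝ) {l : List (Fin b)} (hl : l.Nodup)
    (S : Finset (Fin N)) :
    ∑ s : Fin b → Fin N, (∏ k, p (s k)) * thinnedValue a f l S s =
      (proposalStep p a)^[l.length] f S := by
  induction l generalizing S with
  | nil =>
    simp only [thinnedValue, List.length_nil, Function.iterate_zero, id, ← Finset.sum_mul]
    have := Finset.prod_univ_sum (fun _ : Fin b => (Finset.univ : Finset (Fin N))) (fun _ j => p j)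
    rw [Fintype.piFinset_univ] at this
    rw [← this, hp]
    simp
  | cons i l ih =>
    rw [List.nodup_cons] at hl
    rw [sum_prod_resample p hp _ i, List.length_cons, Function.iterate_succ_apply', proposalStep]
    simp only [thinnedValue, Function.update_self, thinnedValue_update a f hl.1, Finset.mul_sum]
    rw [Finset.sum_comm]
    refine Finset.sum_congr rfl fun j _ => ?_
    rw [← ih hl.2, ← ih hl.2, Finset.mul_sum, Finset.mul_sum, ← Finset.sum_add_distrib,
      Finset.mul_sum]
    exact Finset.sum_congr rfl fun s _ => by ring

theorem proposalStep_affine {p : Fin N → ℝ} (hp : ∑ j, p j = 1)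
    (a : Fin N → Finset (Fin N) → ℝ) (c d : ℝ) (f : Finset (Fin N) → ℝ) :
    proposalStep p a (fun S => c * f S + d) = fun S => c * proposalStep p a f S + d := by
  ext S
  calc _ = ∑ j, (c * (p j * (a j S * f (insert j S) + (1 - a j S) * f S)) + p j * d) :=
        Finset.sum_congr rfl fun j _ => by ring
    _ = _ := by rw [Finset.sum_add_distrib, ← Finset.mul_sum, ← Finset.sum_mul, hp, one_mul]; rfl

theorem iterate_proposalStep_affine {p : Fin N → ℝ} (hp : ∑ j, p j = 1)
    (a : Fin N → Finset (Fin N) → ℝ) (c d : ℝ) (f : Finset (Fin N) → ℝ) (n : ℕ) :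
    (proposalStep p a)^[n] (fun S => c * f S + d) =
      fun S => c * (proposalStep p a)^[n] f S + d := by
  induction n with
  | zero => rfl
  | succ n ih => rw [Function.iterate_succ_apply', ih, proposalStep_affine hp,
      Function.iterate_succ_apply']

theorem iterate_proposalStep_mono {p : Fin N → ℝ} (hp : ∀ j, 0 ≤ p j)
    {a : Fin N → Finset (Fin N) → ℝ} (ha : ∀ j S, 0 ≤ a j S) (ha1 : ∀ j S, a j S ≤ 1)
    {f g : Finset (Fin N) → ℝ} {S₀ : Finset (Fin N)} (hfg : ∀ S, S₀ ⊆ S → f S ≤ g S) (n : ℕ)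
    {S : Finset (Fin N)} (hS : S₀ ⊆ S) :
    (proposalStep p a)^[n] f S ≤ (proposalStep p a)^[n] g S := by
  induction n generalizing S with
  | zero => exact hfg S hS
  | succ n ih =>
    rw [Function.iterate_succ_apply', Function.iterate_succ_apply']
    refine Finset.sum_le_sum fun j _ => mul_le_mul_of_nonneg_left (add_le_add ?_ ?_) (hp j)
    · exact mul_le_mul_of_nonneg_left (ih (hS.trans (Finset.subset_insert j S))) (ha j S)
    · exact mul_le_mul_of_nonneg_left (ih hS) (sub_nonneg.2 (ha1 j S))

/-! ### One round -/

section Round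

variable (B : Matrix (Fin M) (Fin N) ℂ)

theorem expectation_rejectionLoop (S₀ S : Finset (Fin N)) (s : Fin b → Fin N)
    (f : Finset (Fin N) → ℝ) (l : List (Fin b)) :
    expectation (rejectionLoop (fun i => columnMass B S₀ (s i)) l (residualGram B S s))
        (fun T => f (S ∪ T.image s)) =
      thinnedValue (fun j S => (acceptanceProb (columnMass B S₀ j) (columnMass B S j) : ℝ))
        f l S s := by
  induction l generalizing S with
  | nil => simp [rejectionLoop, thinnedValue, expectation_pure]
  | cons i l ih =>
    rw [rejectionLoop, expectation_bind]
    refine (expectation_coin _ _ _).trans ?_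
    rw [thinnedValue, ← ih, ← ih, residualGram_diag_re, choleskyStep_residualGram]
    simp [expectation_map, Finset.image_insert]

theorem toReal_proposalLaw {S : Finset (Fin N)} (hC : qrResidual B S ≠ 0) (j : Fin N) :
    (proposalLaw (qrResidual B S) hC j).toReal = columnMass B S j / ‖qrResidual B S‖ ^ 2 := by
  rw [proposalLaw, PMF.normalize_apply, tsum_fintype, ENNReal.toReal_mul, ENNReal.toReal_inv,
    ENNReal.toReal_sum fun _ _ => ENNReal.ofReal_ne_top, norm_qrResidual_sq, div_eq_mul_inv]
  simp only [squaredColumnNorms_qrResidual, ENNReal.toReal_ofReal (columnMass_nonneg B S _)]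

theorem expectation_iidLaw (p : PMF (Fin N)) (h : (Fin b → Fin N) → ℝ) :
    expectation (iidLaw b p) h = ∑ s, (∏ l, (p (s l)).toReal) * h s := by
  simp [expectation, iidLaw, ENNReal.toReal_prod]

theorem expectation_acceleratedRound {S : Finset (Fin N)} (hC : qrResidual B S ≠ 0)
    (f : Finset (Fin N) → ℝ) :
    expectation (acceleratedRound b B S) f =
      (proposalStep (fun j => columnMass B S j / ‖qrResidual B S‖ ^ 2)
        fun j S' => (acceptanceProb (columnMass B S j) (columnMass B S' j) : ℝ))^[b] f S := by
  have hp : ∑ j, columnMass B S j / ‖qrResidual B S‖ ^ 2 = 1 := by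
    rw [← Finset.sum_div, norm_qrResidual_sq]
    refine div_self ?_
    rw [← norm_qrResidual_sq]
    simpa using hC
  have h := sum_prod_mul_thinnedValue _ hp
    (fun j S' => (acceptanceProb (columnMass B S j) (columnMass B S' j) : ℝ)) f
    (List.nodup_finRange b) S
  rw [List.length_finRange] at h
  rw [← h, acceleratedRound, dif_pos hC, expectation_bind, expectation_iidLaw]
  refine Finset.sum_congr rfl fun s _ => ?_
  simp only [toReal_proposalLaw]
  rw [expectation_map, conjTranspose_mul_submatrix_qrResidual, ← expectation_rejectionLoop,
    rejectionSample]
  simp only [residualGram_diag_re]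

/-- Block pivoting keeps all proposals, and hence does at least as well within one round as
accelerated pivoting, which keeps some of them. -/
theorem expectation_blockRound_le {f : Finset (Fin N) → ℝ} (hf : Antitone f)
    (S : Finset (Fin N)) :
    expectation (blockRound b B S) f ≤ expectation (acceleratedRound b B S) f := by
  rw [blockRound, acceleratedRound]
  split_ifs with hC
  · rw [expectation_map, expectation_bind]
    refine expectation_mono _ fun s => ?_
    rw [expectation_map, ← expectation_const (rejectionSample _) (f _)]
    exact expectation_mono _ fun T => hf
      (Finset.union_subset_union le_rfl (Finset.image_subset_image (Finset.subset_univ T)))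
  · exact le_rfl

/-- In a round started from `S`, a proposal examined with pivot set `S'` adds the index `j` with
probability `columnMass B S' j / ‖qrResidual B S‖ ^ 2`: the mass `columnMass B S j` of the proposal
cancels against the denominator of the acceptance probability. -/
theorem proposalStep_headMass_le {S S' : Finset (Fin N)} (hC : qrResidual B S ≠ 0) (hS : S ⊆ S')
    {r : ℕ} (hr : 0 < r) :
    proposalStep (fun j => columnMass B S j / ‖qrResidual B S‖ ^ 2)
        (fun j S' => (acceptanceProb (columnMass B S j) (columnMass B S' j) : ℝ))
        (headMass B r) S' ≤
      headMass B r S' - headMass B r S' ^ 2 / (r * ‖qrResidual B S‖ ^ 2) := by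
  have hτ : 0 < ‖qrResidual B S‖ ^ 2 := by
    have := norm_pos_iff.2 hC
    positivity
  have hp : ∑ j, columnMass B S j / ‖qrResidual B S‖ ^ 2 = 1 := by
    rw [← Finset.sum_div, ← norm_qrResidual_sq, div_self hτ.ne']
  have hacc : ∀ j, columnMass B S j *
      (acceptanceProb (columnMass B S j) (columnMass B S' j) : ℝ) = columnMass B S' j := by
    intro j
    have h0 := columnMass_nonneg B S' j
    have h1 := columnMass_antitone B hS j
    rcases (columnMass_nonneg B S j).eq_or_lt with h | h
    · rw [← h] at h1 ⊢
      rw [zero_mul]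
      exact le_antisymm h0 h1
    · rw [acceptanceProb, NNReal.coe_min, Real.coe_toNNReal _ (by positivity), NNReal.coe_one,
        min_eq_right ((div_le_one h).2 h1), mul_div_cancel₀ _ h.ne']
  have key := headMass_sq_le B S' r
  have hstep : proposalStep (fun j => columnMass B S j / ‖qrResidual B S‖ ^ 2)
        (fun j S' => (acceptanceProb (columnMass B S j) (columnMass B S' j) : ℝ))
        (headMass B r) S' = headMass B r S' -
      (∑ j, columnMass B S' j * (headMass B r S' - headMass B r (insert j S'))) /
        ‖qrResidual B S‖ ^ 2 := by
    rw [proposalStep, Finset.sum_div, eq_sub_iff_add_eq, ← Finset.sum_add_distrib]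
    calc _ = ∑ j, columnMass B S j / ‖qrResidual B S‖ ^ 2 * headMass B r S' := by
          refine Finset.sum_congr rfl fun j _ => ?_
          linear_combination (headMass B r (insert j S') - headMass B r S') /
            ‖qrResidual B S‖ ^ 2 * hacc j
      _ = _ := by rw [← Finset.sum_mul, hp, one_mul]
  rw [hstep, mul_comm, ← div_div]
  have hr' : (0 : ℝ) < r := by exact_mod_cast hr
  rw [sub_le_sub_iff_left, div_right_comm]
  gcongr
  rwa [div_le_iff₀' hr']

/-- If `y ≤ x - x² / c` with `x, c` positive, then `1 / y ≥ 1 / x + 1 / c`; summed over `n` steps and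
written without division. -/
theorem mul_add_le_of_forall_le_sub_sq {c : ℝ} (hc : 0 < c) {y : ℕ → ℝ} (hy : ∀ n, 0 ≤ y n)
    (h : ∀ n, y (n + 1) ≤ y n - y n ^ 2 / c) (n : ℕ) :
    y n * (c + n * y 0) ≤ c * y 0 := by
  induction n with
  | zero => simp [mul_comm]
  | succ n ih =>
    have hstep : y (n + 1) * (c + y n) ≤ c * y n := by
      have h1 : y (n + 1) * (c + y n) ≤ (y n - y n ^ 2 / c) * (c + y n) :=
        mul_le_mul_of_nonneg_right (h n) (by linarith [hy n])
      have h2 : (y n - y n ^ 2 / c) * (c + y n) = c * y n - y n ^ 3 / c := by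
        field_simp
        ring
      have h3 : 0 ≤ y n ^ 3 / c := div_nonneg (pow_nonneg (hy n) 3) hc.le
      linarith
    rcases (hy (n + 1)).eq_or_lt with h0 | h0
    · rw [← h0, zero_mul]
      exact mul_nonneg hc.le (hy 0)
    have hn : 0 < y n := by
      rcases (hy n).eq_or_lt with h1 | h1
      · rw [← h1] at hstep
        nlinarith
      · exact h1
    -- Divide the product of the two bounds by `y n`.
    have h4 : y (n + 1) * (c + n * y 0) * y n ≤ (c * y 0 - y (n + 1) * y 0) * y n := by
      have h5 := mul_le_mul_of_nonneg_left ih h0.le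
      have h6 := mul_le_mul_of_nonneg_left hstep (hy 0)
      nlinarith
    have h7 := le_of_mul_le_mul_right h4 hn
    push_cast
    linarith

/-- A round of `b` proposals replaces the head mass `α` by at most the parallel sum of `α` and
`r τ / b`, where `τ` is the squared norm of the residual at the start of the round. -/
theorem expectation_acceleratedRound_headMass {r : ℕ} (hr : 0 < r) {S : Finset (Fin N)}
    (hC : qrResidual B S ≠ 0) :
    expectation (acceleratedRound b B S) (headMass B r) *
        (r * ‖qrResidual B S‖ ^ 2 + b * headMass B r S) ≤
      r * ‖qrResidual B S‖ ^ 2 * headMass B r S := by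
  have hr' : (0 : ℝ) < r := by exact_mod_cast hr
  have hτ : 0 < ‖qrResidual B S‖ ^ 2 := by
    have := norm_pos_iff.2 hC
    positivity
  have hp : ∑ j, columnMass B S j / ‖qrResidual B S‖ ^ 2 = 1 := by
    rw [← Finset.sum_div, ← norm_qrResidual_sq, div_self hτ.ne']
  have hp0 : ∀ j, 0 ≤ columnMass B S j / ‖qrResidual B S‖ ^ 2 :=
    fun j => div_nonneg (columnMass_nonneg B S j) hτ.le
  set p : Fin N → ℝ := fun j => columnMass B S j / ‖qrResidual B S‖ ^ 2
  set a : Fin N → Finset (Fin N) → ℝ :=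
    fun j S' => (acceptanceProb (columnMass B S j) (columnMass B S' j) : ℝ) with ha_def
  have ha0 : ∀ j S', 0 ≤ a j S' := fun _ _ => NNReal.coe_nonneg _
  have ha1 : ∀ j S', a j S' ≤ 1 := fun _ _ => by
    rw [ha_def]
    exact_mod_cast min_le_left _ _
  set c := r * ‖qrResidual B S‖ ^ 2
  have hc : 0 < c := mul_pos hr' hτ
  rw [expectation_acceleratedRound B hC]
  refine mul_add_le_of_forall_le_sub_sq hc (y := fun n => (proposalStep p a)^[n] (headMass B r) S)
    (fun n => ?_) (fun n => ?_) b
  · have h := iterate_proposalStep_mono (S₀ := S) hp0 ha0 ha1 (f := fun S => 0 * headMass B r S + 0)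
      (g := headMass B r) (fun S' _ => by simpa using headMass_nonneg B S' r) n le_rfl
    rw [iterate_proposalStep_affine hp] at h
    simpa using h
  · -- Linearize the square at the current expected head mass `m`.
    set m := (proposalStep p a)^[n] (headMass B r) S with hm
    have h : ∀ S', S ⊆ S' → proposalStep p a (headMass B r) S' ≤
        (1 - 2 * m / c) * headMass B r S' + m ^ 2 / c := by
      intro S' hS
      refine (proposalStep_headMass_le B hC hS hr).trans ?_
      have h1 : (1 - 2 * m / c) * headMass B r S' + m ^ 2 / c -
          (headMass B r S' - headMass B r S' ^ 2 / c) = (headMass B r S' - m) ^ 2 / c := by ring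
      have h2 : 0 ≤ (headMass B r S' - m) ^ 2 / c := by positivity
      linarith
    rw [Function.iterate_succ_apply]
    refine (iterate_proposalStep_mono hp0 ha0 ha1 h n le_rfl).trans (le_of_eq ?_)
    rw [iterate_proposalStep_affine hp]
    change (1 - 2 * m / c) * m + m ^ 2 / c = _
    ring

/-- The bound for one round, relaxed to one that is linear in the head mass and the squared norm of
the residual, so that it can be averaged over the pivot set at the start of the round. -/
theorem expectation_acceleratedRound_le_linear {r : ℕ} (hr : 0 < r) (hb : 1 ≤ b)
    (S : Finset (Fin N)) (θ : ℝ) :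
    expectation (acceleratedRound b B S) (headMass B r) ≤
      θ ^ 2 * headMass B r S + (1 - θ) ^ 2 * (r / b) * ‖qrResidual B S‖ ^ 2 := by
  have hr' : (0 : ℝ) < r := by exact_mod_cast hr
  have hb' : (0 : ℝ) < b := by exact_mod_cast hb
  by_cases hC : qrResidual B S = 0
  · have h0 : headMass B r S = 0 := by
      have h := headMass_sq_le B S r
      have h1 : ∀ j, columnMass B S j = 0 := fun j =>
        (Finset.sum_eq_zero_iff_of_nonneg fun j _ => columnMass_nonneg B S j).1
          (by rw [← norm_qrResidual_sq, hC]; simp) j (Finset.mem_univ j)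
      simp only [h1, zero_mul, Finset.sum_const_zero, mul_zero] at h
      nlinarith
    rw [acceleratedRound, dif_neg (not_not.2 hC), expectation_pure, h0, hC]
    simp
  · have hτ : 0 < ‖qrResidual B S‖ ^ 2 := by
      have := norm_pos_iff.2 hC
      positivity
    have hα := headMass_nonneg B S r
    have h := expectation_acceleratedRound_headMass (b := b) B hr hC
    set α := headMass B r S
    set τ := ‖qrResidual B S‖ ^ 2
    have hpos : 0 < r * τ + b * α := by positivity
    rw [← le_div_iff₀ hpos] at h
    refine h.trans ?_
    rw [div_le_iff₀ hpos]
    have h1 : (θ ^ 2 * α + (1 - θ) ^ 2 * (r / b) * τ) * (r * τ + b * α) - r * τ * α =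
        (θ * (b * α) - (1 - θ) * (r * τ)) ^ 2 / b := by
      field_simp
      ring
    have h2 : 0 ≤ (θ * (b * α) - (1 - θ) * (r * τ)) ^ 2 / b := by positivity
    linarith

end Round

/-! ### Many rounds -/

/-- A round that replaces `x` by at most the parallel sum of `x` and `r (x + β) / b` raises the
potential `(r + b) log (1 / x) + r β / x` by at least `b`. -/
theorem le_potential_sub_potential {r b β x y : ℝ} (hr : 0 < r) (hb : 0 < b) (hβ : 0 < β)
    (hx : 0 < x) (hy : 0 < y) (h : y * (r * (x + β) + b * x) ≤ r * (x + β) * x) :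
    b ≤ (r + b) * Real.log (x / y) + r * β * (1 / y - 1 / x) := by
  have hxy : y ≤ x := by
    by_contra hlt
    rw [not_le] at hlt
    have h1 : r * (x + β) * x < r * (x + β) * y := by gcongr
    have h2 : 0 < y * (b * x) := by positivity
    nlinarith
  -- If the head sum vanishes, then `η` takes the junk value `0`, and both sides are `0`.
  have hlog : 1 - y / x ≤ Real.log (x / y) := by
    have := Real.one_sub_inv_le_log_of_pos (div_pos hx hy)
    rwa [inv_div] at this
  have h1 : b ≤ (r + b) * (1 - y / x) + r * β * ((x - y) / x ^ 2) := by
    have h2 : (r + b) * (1 - y / x) + r * β * ((x - y) / x ^ 2) - b =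
        (r * (x + β) * x - y * (r * (x + β) + b * x)) / x ^ 2 := by
      field_simp
      ring
    have h3 : 0 ≤ (r * (x + β) * x - y * (r * (x + β) + b * x)) / x ^ 2 :=
      div_nonneg (sub_nonneg.2 h) (by positivity)
    linarith
  have h2 : (x - y) / x ^ 2 ≤ 1 / y - 1 / x := by
    rw [div_sub_div _ _ hy.ne' hx.ne', one_mul, mul_one, sq]
    exact div_le_div_of_nonneg_left (sub_nonneg.2 hxy) (by positivity) (by gcongr)
  calc b ≤ _ := h1
    _ ≤ _ := by gcongr

/-- While `x n` exceeds `ε β`, the potential stays below `r / ε - (r + b) log (ε β)`, which leaves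
room for fewer than `t` rounds. -/
theorem le_of_forall_round {r b β ε : ℝ} (hr : 0 < r) (hb : 0 < b) (hβ : 0 < β) (hε : 0 < ε)
    {x : ℕ → ℝ} (hx : ∀ n, 0 ≤ x n)
    (h : ∀ n, x (n + 1) * (r * (x n + β) + b * x n) ≤ r * (x n + β) * x n) {t : ℕ}
    (ht : r / ε + (r + b) * Real.log (x 0 / (ε * β)) ≤ t * b) : x t ≤ ε * β := by
  have hpos : ∀ n, 0 < x (n + 1) → 0 < x n := by
    intro n hn
    refine (hx n).lt_of_ne fun h0 => ?_
    have h1 := h n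
    rw [← h0] at h1
    have h2 : 0 < x (n + 1) * (r * β) := by positivity
    simp only [zero_add, mul_zero, add_zero] at h1
    linarith
  have htel : ∀ n, 0 < x n → 0 < x 0 ∧
      n * b ≤ (r + b) * Real.log (x 0 / x n) + r * β * (1 / x n - 1 / x 0) := by
    intro n
    induction n with
    | zero => intro h0; simp [h0, h0.ne']
    | succ n ih =>
      intro hn
      obtain ⟨h0, h1⟩ := ih (hpos n hn)
      have h2 := le_potential_sub_potential hr hb hβ (hpos n hn) hn (h n)
      refine ⟨h0, ?_⟩
      rw [Real.log_div h0.ne' (hpos n hn).ne'] at h1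
      rw [Real.log_div (hpos n hn).ne' hn.ne'] at h2
      rw [Real.log_div h0.ne' hn.ne']
      push_cast
      linarith
  by_contra hlt
  rw [not_le] at hlt
  have hεβ : 0 < ε * β := mul_pos hε hβ
  obtain ⟨h0, h1⟩ := htel t (hεβ.trans hlt)
  have h2 : Real.log (x 0 / x t) ≤ Real.log (x 0 / (ε * β)) :=
    Real.log_le_log (div_pos h0 (hεβ.trans hlt)) (by gcongr)
  have h3 : (r + b) * Real.log (x 0 / x t) ≤ (r + b) * Real.log (x 0 / (ε * β)) := by gcongr
  have h4 : r * β * (1 / x t) ≤ r / ε := by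
    calc r * β * (1 / x t) ≤ r * β * (1 / (ε * β)) := by gcongr
      _ = r / ε := by field_simp
  have h5 : 0 < r * β * (1 / x 0) := by positivity
  linarith

/-- The error bound for any pivoting rule whose rounds satisfy the linear bound on the expected
head mass. -/
theorem expectedSquaredError_le {B : Matrix (Fin M) (Fin N) ℂ} {r : ℕ} {ε : ℝ} (hb : 1 ≤ b)
    (hε : 0 < ε) (htail : 0 < tailSum B r) {round : Finset (Fin N) → PMF (Finset (Fin N))}
    {pivots : ℕ → PMF (Finset (Fin N))} (hzero : pivots 0 = PMF.pure ∅)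
    (hsucc : ∀ n, pivots (n + 1) = (pivots n).bind round)
    (hround : 0 < r → ∀ S θ, expectation (round S) (headMass B r) ≤
      θ ^ 2 * headMass B r S + (1 - θ) ^ 2 * (r / b) * ‖qrResidual B S‖ ^ 2) {t : ℕ}
    (ht : (r : ℝ) / ε + (r + b) * Real.log (headSum B r / (ε * tailSum B r)) ≤ t * b) :
    expectedSquaredError B (pivots t) ≤ (1 + ε) * tailSum B r := by
  have hrN : r ≤ N := by
    by_contra hlt
    rw [tailSum, Finset.Ico_eq_empty (by omega), Finset.sum_empty] at htail
    exact htail.false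
  have hsplit : ∀ p : PMF (Finset (Fin N)), expectation p (fun S => ‖qrResidual B S‖ ^ 2) ≤
      expectation p (headMass B r) + tailSum B r := by
    intro p
    rw [← expectation_const p (tailSum B r), ← expectation_add]
    exact expectation_mono p fun S => norm_qrResidual_sq_le B S
  have hnonneg : ∀ p : PMF (Finset (Fin N)), 0 ≤ expectation p (headMass B r) := fun p =>
    Finset.sum_nonneg fun S _ => mul_nonneg ENNReal.toReal_nonneg (headMass_nonneg B S r)
  suffices hhead : expectation (pivots t) (headMass B r) ≤ ε * tailSum B r by
    have := hsplit (pivots t)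
    change expectation (pivots t) (fun S => ‖qrResidual B S‖ ^ 2) ≤ _
    linarith
  have h0 : expectation (pivots 0) (headMass B r) = headSum B r := by
    rw [hzero, expectation_pure, headMass_empty B hrN]
  -- If the head sum vanishes, in particular if `r = 0`, then so does every head mass.
  rcases (hnonneg (pivots 0)).eq_or_lt with hh | hh
  · have h1 : expectation (pivots t) (headMass B r) ≤ headSum B r := by
      rw [← expectation_const (pivots t) (headSum B r), ← headMass_empty B hrN]
      exact expectation_mono _ fun S => headMass_antitone B r (Finset.empty_subset S)
    have h2 : 0 < ε * tailSum B r := mul_pos hε htail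
    linarith
  have hr : 0 < r := by
    rw [h0] at hh
    refine Nat.pos_of_ne_zero fun hr => ?_
    simp [headSum, hr] at hh
  have hr' : (0 : ℝ) < r := by exact_mod_cast hr
  have hb' : (0 : ℝ) < b := by exact_mod_cast hb
  refine le_of_forall_round (x := fun n => expectation (pivots n) (headMass B r)) hr' hb' htail hε
    (fun n => hnonneg _) (fun n => ?_) (by rwa [h0])
  set x := expectation (pivots n) (headMass B r) with hx
  have hx0 : 0 ≤ x := hnonneg _
  have hpos : 0 < r * (x + tailSum B r) + b * x := by positivity
  -- This weight minimizes the averaged bound.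
  set θ := r * (x + tailSum B r) / (r * (x + tailSum B r) + b * x) with hθ
  have h1 : expectation (pivots (n + 1)) (headMass B r) ≤
      θ ^ 2 * x + (1 - θ) ^ 2 * (r / b) * (x + tailSum B r) := by
    rw [hsucc, expectation_bind]
    refine (expectation_mono _ fun S => hround hr S θ).trans ?_
    rw [expectation_add, expectation_const_mul, expectation_const_mul, ← hx]
    gcongr
    exact hsplit _
  calc _ ≤ (θ ^ 2 * x + (1 - θ) ^ 2 * (r / b) * (x + tailSum B r)) *
        (r * (x + tailSum B r) + b * x) := mul_le_mul_of_nonneg_right h1 hpos.le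
    _ = r * (x + tailSum B r) * x := by
      have : 1 - θ = b * x / (r * (x + tailSum B r) + b * x) := by
        rw [hθ, eq_div_iff hpos.ne', sub_mul, div_mul_cancel₀ _ hpos.ne']
        ring
      rw [this, hθ]
      field_simp

end RPQR
end

theorem mainTheorem2 (M N : ℕ) (B : Matrix (Fin M) (Fin N) ℂ) (b t r : ℕ) (ε η : ℝ)
    (hb : 1 ≤ b) (hε : 0 < ε) (htail : 0 < RPQR.tailSum B r)
    (hη : η = RPQR.tailSum B r / RPQR.headSum B r)
    (ht : (r : ℝ) / ε + ((r : ℝ) + (b : ℝ)) * Real.log (1 / (ε * η)) ≤ (t : ℝ) * (b : ℝ)) :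
    RPQR.expectedSquaredError B (RPQR.acceleratedPivots b B t)
        ≤ (1 + ε) * RPQR.tailSum B r ∧
      RPQR.expectedSquaredError B (RPQR.blockPivots b B t)
        ≤ (1 + ε) * RPQR.tailSum B r := by
  -- If the head sum vanishes, then `η` takes the junk value `0`, and both sides are `0`.
  have hlog : 1 / (ε * η) = RPQR.headSum B r / (ε * RPQR.tailSum B r) := by
    rw [hη, mul_div_assoc', one_div_div]
  rw [hlog] at ht
  have hacc := fun hr => RPQR.expectation_acceleratedRound_le_linear B (r := r) hr hb
  exact ⟨RPQR.expectedSquaredError_le hb hε htail rfl (fun _ => rfl) hacc ht,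
    RPQR.expectedSquaredError_le hb hε htail rfl (fun _ => rfl)
      (fun hr S θ => (RPQR.expectation_blockRound_le B (RPQR.headMass_antitone B r) S).trans
        (hacc hr S θ)) ht⟩
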